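/- Let $\mathcal D$ be a triangulated category with a bounded t-structure $(\mathcal D^{\le 0},\mathcal D^{\ge 0})$ (that is, every object of $\mathcal D$ lies in $\mathcal D^{\le n}\cap\mathcal D^{\ge m}$ for some integers $m,n$), and let $\mathcal A=\mathcal D^{\le 0}\cap\mathcal D^{\ge 0}$ be its heart, which is an abelian category. Let $(\mathcal T,\mathcal F)$ be a torsion pair in $\mathcal A$, i.e. a pair of full subcategories of $\mathcal A$, closed under isomorphisms, such that $\operatorname{Hom}(T,F)=0$ for all $T\in\mathcal T$, $F\in\mathcal F$, and such that every $E\in\mathcal A$ fits into a short exact sequence $0\to T\to E\to F\to 0$ in $\mathcal A$ with $T\in\mathcal T$ and $F\in\mathcal F$. Let $\mathcal A^{\#}=\langle\mathcal F,\mathcal T[-1]\rangle$ be the tilted heart: the smallest full subcategory of $\mathcal D$ that contains $\mathcal F$ and $\mathcal T[-1]$ and is closed under isomorphisms and under extensions (if $X\to Y\to Z\to X[1]$ is a distinguished triangle with $X$ and $Z$ in the subcategory, then $Y$ is in it). Let $\mathcal A^{\#}[1]$ be the full subcategory of the objects $X$ of $\mathcal D$ with $X[-1]\in\mathcal A^{\#}$.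 Note that $\mathcal F\subset\mathcal A^{\#}$ and $\mathcal T\subset\mathcal A^{\#}[1]$. (i) Let $E_0\in\mathcal F$, let $E\in\mathcal A^{\#}$, and let $\alpha\colon E_0\to E$ be a morphism in $\mathcal A^{\#}$. Then $\alpha$ is an epimorphism in $\mathcal A^{\#}$ if and only if $\alpha$ is a morphism in $\mathcal A$ with $E\in\mathcal F$ and the cokernel of $\alpha$ taken in $\mathcal A$ lies in $\mathcal T$. (ii) Let $E_0\in\mathcal T$, let $E\in\mathcal A^{\#}[1]$, and let $\beta\colon E\to E_0$ be a morphism in $\mathcal A^{\#}[1]$. Then $\beta$ is a monomorphism in $\mathcal A^{\#}[1]$ if and only if $\beta$ is a morphism in $\mathcal A$ with $E\in\mathcal T$ and the kernel of $\beta$ taken in $\mathcal A$ lies in $\mathcal F$. -/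

import Mathlib

open CategoryTheory CategoryTheory.Limits CategoryTheory.Pretriangulated
  CategoryTheory.Triangulated

namespace Tilting

universe v u

/-- A torsion pair `(T, F)` in an abelian category: two strictly full subcategories with
`Hom(T, F) = 0` such that every object `E` fits into a short exact sequence
`0 ⟶ X ⟶ E ⟶ Y ⟶ 0` with `X` in `T` and `Y` in `F`. -/
structure TorsionPair (A : Type u) [Category.{v} A] [Abelian A] where
  /-- the torsion class -/
  T : ObjectProperty A
  /-- the torsion-free class -/
  F : ObjectProperty A
  closed_T : T.IsClosedUnderIsomorphisms
  closed_F : F.IsClosedUnderIsomorphisms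
  hom_eq_zero : ∀ ⦃X Y : A⦄ (f : X ⟶ Y), T X → F Y → f = 0
  exists_shortExact : ∀ E : A, ∃ (X Y : A) (i : X ⟶ E) (p : E ⟶ Y) (w : i ≫ p = 0),
    T X ∧ F Y ∧ (ShortComplex.mk i p w).ShortExact

variable {D : Type u} [Category.{v} D] [Preadditive D] [HasZeroObject D] [HasShift D ℤ]
  [∀ n : ℤ, (shiftFunctor D n).Additive] [Pretriangulated D]

/-- The extension-closure of a class `P` of objects in a triangulated category: the smallest
class of objects which contains `P` and is closed under isomorphisms and under extensions. -/
inductive extensionClosure (P : ObjectProperty D) : D → Prop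
  | of (X : D) (hX : P X) : extensionClosure P X
  | of_iso (X Y : D) (e : X ≅ Y) (hX : extensionClosure P X) : extensionClosure P Y
  | ext (X Y Z : D) (f : X ⟶ Y) (g : Y ⟶ Z) (h : Z ⟶ X⟦(1 : ℤ)⟧)
      (hT : Triangle.mk f g h ∈ distTriang D)
      (hX : extensionClosure P X) (hZ : extensionClosure P Z) : extensionClosure P Y

lemma triangle_mk_distinguished_of_iso {X X' Y Z : D} (e : X' ≅ X) (f : X ⟶ Y) (g : Y ⟶ Z)
    (h : Z ⟶ X⟦(1 : ℤ)⟧) (hT : Triangle.mk f g h ∈ distTriang D) :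
    Triangle.mk (e.hom ≫ f) g (h ≫ e.inv⟦(1 : ℤ)⟧') ∈ distTriang D :=
  isomorphic_distinguished _ hT _ (Triangle.isoMk _ _ e (Iso.refl Y) (Iso.refl Z)
    (Category.comp_id (e.hom ≫ f))
    ((Category.comp_id g).trans (Category.id_comp g).symm)
    (show (h ≫ e.inv⟦(1 : ℤ)⟧') ≫ e.hom⟦(1 : ℤ)⟧' = 𝟙 Z ≫ h by
      rw [Category.assoc, ← Functor.map_comp, e.inv_hom_id, CategoryTheory.Functor.map_id, Category.comp_id,
        Category.id_comp]))

variable (t : TStructure D)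

lemma heart_isClosedUnderFiniteProducts : t.heart.IsClosedUnderFiniteProducts := by
  have : t.heart.ContainsZero :=
    ⟨_, isZero_zero D, (t.isLE_of_isZero (isZero_zero D) 0).le,
      (t.isGE_of_isZero (isZero_zero D) 0).ge⟩
  have : t.heart.IsClosedUnderBinaryProducts :=
    ⟨by
      rintro X ⟨p⟩
      have h₁ := p.prop_diag_obj ⟨WalkingPair.left⟩
      have h₂ := p.prop_diag_obj ⟨WalkingPair.right⟩
      have hT := binaryProductTriangle_distinguished
        (p.diag.obj ⟨WalkingPair.left⟩) (p.diag.obj ⟨WalkingPair.right⟩)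
      refine t.heart.prop_of_iso (IsLimit.conePointUniqueUpToIso (prodIsProd _ _)
        ((IsLimit.postcomposeHomEquiv (diagramIsoPair p.diag) _).2 p.isLimit)) ?_
      exact ⟨(t.isLE₂ _ hT 0 ⟨h₁.1⟩ ⟨h₂.1⟩).le, (t.isGE₂ _ hT 0 ⟨h₁.2⟩ ⟨h₂.2⟩).ge⟩⟩
  exact .mk'

lemma heart_hom_shift_eq_zero ⦃X Y : t.heart.FullSubcategory⦄ ⦃n : ℤ⦄
    (f : t.heart.ι.obj X ⟶ (t.heart.ι.obj Y)⟦n⟧) (hn : n < 0) : f = 0 := by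
  have hX : t.IsLE (t.heart.ι.obj X) 0 := ⟨X.property.1⟩
  have hY : t.IsGE (t.heart.ι.obj Y) 0 := ⟨Y.property.2⟩
  have : t.IsGE ((t.heart.ι.obj Y)⟦n⟧) (-n) := t.isGE_shift _ 0 n (-n)
  exact t.zero f 0 (-n)

variable [IsTriangulated D]

lemma heart_admissibleMorphism :
    AbelianSubcategory.admissibleMorphism t.heart.ι = ⊤ := by
  ext X₁ X₂ f₁
  simp only [MorphismProperty.top_apply, iff_true]
  intro X₃ f₂ f₃ hT
  have h₁ : t.IsLE (t.heart.ι.obj X₁) 0 := ⟨X₁.property.1⟩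
  have h₁' : t.IsGE (t.heart.ι.obj X₁) 0 := ⟨X₁.property.2⟩
  have h₂ : t.IsLE (t.heart.ι.obj X₂) 0 := ⟨X₂.property.1⟩
  have h₂' : t.IsGE (t.heart.ι.obj X₂) 0 := ⟨X₂.property.2⟩
  have h₄ : t.IsLE ((t.heart.ι.obj X₁)⟦(1 : ℤ)⟧) (-1) := t.isLE_shift _ 0 1 (-1)
  have h₄' : t.IsGE ((t.heart.ι.obj X₁)⟦(1 : ℤ)⟧) (-1) := t.isGE_shift _ 0 1 (-1)
  have h₅ : t.IsLE ((t.heart.ι.obj X₁)⟦(1 : ℤ)⟧) 0 := t.isLE_of_le _ (-1) 0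
  have h₆ : t.IsGE (t.heart.ι.obj X₂) (-1) := t.isGE_of_ge _ (-1) 0
  have h₃ : t.IsLE X₃ 0 :=
    t.isLE₂ _ (rot_of_distTriang _ hT) 0 h₂ h₅
  have h₃' : t.IsGE X₃ (-1) :=
    t.isGE₂ _ (rot_of_distTriang _ hT) (-1) h₆ h₄'
  let L := (t.truncLE (-1)).obj X₃
  let G := (t.truncGE 0).obj X₃
  have hL : t.IsLE (L⟦(-1 : ℤ)⟧) 0 := t.isLE_shift _ (-1) (-1) 0
  have hL' : t.IsGE (L⟦(-1 : ℤ)⟧) 0 := t.isGE_shift _ (-1) (-1) 0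
  have hG : t.IsLE G 0 := inferInstance
  have hG' : t.IsGE G 0 := inferInstance
  let e : (L⟦(-1 : ℤ)⟧)⟦(1 : ℤ)⟧ ≅ L := (shiftFunctorCompIsoId D (-1) 1 (by simp)).app L
  have hd := t.triangleLEGE_distinguished (-1) 0 (by simp) X₃
  exact ⟨⟨L⟦(-1 : ℤ)⟧, hL.le, hL'.ge⟩, ⟨G, hG.le, hG'.ge⟩, _, _, _,
    triangle_mk_distinguished_of_iso e _ _ _ hd⟩

/-- The heart of a t-structure is an abelian category. -/
noncomputable instance heartAbelian : Abelian t.heart.FullSubcategory :=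
  haveI := heart_isClosedUnderFiniteProducts t
  AbelianSubcategory.abelian t.heart.ι (heart_hom_shift_eq_zero t) (heart_admissibleMorphism t)

variable {t}

/-- The tilt `A^# = ⟨F, T[-1]⟩` of the heart `A` of `t` at a torsion pair `(T, F)`, as a class
of objects of `D`. Recall that `P.shift 1` is the class of the `X` such that `X⟦1⟧` is in `P`,
that is, the class usually denoted `P[-1]`. -/
def TorsionPair.tilt (τ : TorsionPair t.heart.FullSubcategory) : ObjectProperty D :=
  extensionClosure (τ.F.map t.heart.ι ⊔ (τ.T.map t.heart.ι).shift (1 : ℤ))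

/-- The class `A^#[1]` of the objects `X` of `D` such that `X⟦-1⟧` is in `A^#`. -/
def TorsionPair.tiltShift (τ : TorsionPair t.heart.FullSubcategory) : ObjectProperty D :=
  τ.tilt.shift (-1 : ℤ)

/-- `F` is contained in `A^#`. -/
lemma TorsionPair.tilt_of_F (τ : TorsionPair t.heart.FullSubcategory)
    {E : t.heart.FullSubcategory} (hE : τ.F E) : τ.tilt E.obj :=
  .of _ (Or.inl ⟨E, hE, ⟨Iso.refl _⟩⟩)

/-- `T` is contained in `A^#[1]`. -/
lemma TorsionPair.tiltShift_of_T (τ : TorsionPair t.heart.FullSubcategory)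
    {E : t.heart.FullSubcategory} (hE : τ.T E) : τ.tiltShift E.obj :=
  .of _ (Or.inr ⟨E, hE, ⟨((shiftFunctorCompIsoId D (-1 : ℤ) 1 (by simp)).app E.obj).symm⟩⟩)

end Tilting

namespace Tilting

universe v u

section Abelian

variable {A : Type u} [Category.{v} A] [Abelian A] (τ : TorsionPair A)

/-! Each object `X` of `A^#` lies in a triangle `Y ⟶ X ⟶ Z[-1]` with `Y` in `F` and `Z` in `T`
(`exists_triangle_of_tilt`). Everything else is degree vanishing and `Hom(T, F) = 0`. If `α` is epi,
then `E ⟶ Z[-1]` vanishes, since it vanishes on `E₀`; this forces `E ≅ Y` in `F`. Cancelling `α`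
also kills all maps from its cokernel to `F`, so the cokernel is torsion. Conversely, a test map
from `E` in `F` to `G` in `A^#` lifts to the `F`-part of `G`. If `α` kills it, the lift factors
through the torsion cokernel, so it is zero. Part (ii) is dual, using `Y[1] ⟶ X ⟶ Z`. Epi and mono
are handled as cancellation, so `A^#` need not be known to be abelian. -/

/-- An object without nonzero morphisms from torsion objects is torsion-free. -/
lemma TorsionPair.F_of_hom_eq_zero {E : A} (hE : ∀ ⦃X : A⦄ (f : X ⟶ E), τ.T X → f = 0) :
    τ.F E := by
  obtain ⟨X, Y, i, p, w, hX, hY, hS⟩ := τ.exists_shortExact E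
  have : Epi p := hS.epi_g
  have : Mono p := hS.exact.mono_g (hE i hX)
  have : IsIso p := isIso_of_mono_of_epi p
  have := τ.closed_F
  exact τ.F.prop_of_iso (asIso p).symm hY

/-- An object without nonzero morphisms to torsion-free objects is torsion. -/
lemma TorsionPair.T_of_hom_eq_zero {E : A} (hE : ∀ ⦃Y : A⦄ (f : E ⟶ Y), τ.F Y → f = 0) :
    τ.T E := by
  obtain ⟨X, Y, i, p, w, hX, hY, hS⟩ := τ.exists_shortExact E
  have : Mono i := hS.mono_f
  have : Epi i := hS.exact.epi_f (hE p hY)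
  have : IsIso i := isIso_of_mono_of_epi i
  have := τ.closed_T
  exact τ.T.prop_of_iso (asIso i) hX

end Abelian

variable {D : Type u} [Category.{v} D] [Preadditive D] [HasZeroObject D] [HasShift D ℤ]
  [∀ n : ℤ, (shiftFunctor D n).Additive] [Pretriangulated D]

section Heart

variable {t : TStructure D}

lemma heart_isLE (X : t.heart.FullSubcategory) : t.IsLE X.obj 0 := ⟨X.property.1⟩

lemma heart_isGE (X : t.heart.FullSubcategory) : t.IsGE X.obj 0 := ⟨X.property.2⟩

end Heart

variable [IsTriangulated D] {t : TStructure D} (τ : TorsionPair t.heart.FullSubcategory)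

namespace TorsionPair

/-! ### Degrees, orthogonality and canonical triangles of the tilted heart -/

lemma hom_obj_eq_zero {X Y : t.heart.FullSubcategory} (f : X.obj ⟶ Y.obj) (hX : τ.T X)
    (hY : τ.F Y) : f = 0 :=
  congrArg (fun φ : X ⟶ Y ↦ φ.hom) (τ.hom_eq_zero (ObjectProperty.homMk f) hX hY)

/-- `F` sits in degree 0 and `T[-1]` in degree 1, and degree bounds survive extensions. With
`tilt_isLE`, this confines `A^#` to degrees 0 and 1. -/
lemma tilt_isGE {X : D} (hX : τ.tilt X) : t.IsGE X 0 := by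
  induction hX with
  | of X hX =>
    obtain ⟨Y, _, ⟨e⟩⟩ | ⟨Y, _, ⟨e⟩⟩ := hX
    · have : t.IsGE (t.heart.ι.obj Y) 0 := heart_isGE Y
      exact t.isGE_of_iso e 0
    · have : t.IsGE (t.heart.ι.obj Y) 0 := heart_isGE Y
      have : t.IsGE (X⟦(1 : ℤ)⟧) 0 := t.isGE_of_iso e 0
      have := t.isGE_of_shift X 1 1 0
      exact t.isGE_of_ge X 0 1
  | of_iso X Y e _ _ => exact t.isGE_of_iso e 0
  | ext X Y Z f g h hT _ _ hX hZ => exact t.isGE₂ _ hT 0 hX hZ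

lemma tilt_isLE {X : D} (hX : τ.tilt X) : t.IsLE X 1 := by
  induction hX with
  | of X hX =>
    obtain ⟨Y, _, ⟨e⟩⟩ | ⟨Y, _, ⟨e⟩⟩ := hX
    · have : t.IsLE (t.heart.ι.obj Y) 0 := heart_isLE Y
      have : t.IsLE X 0 := t.isLE_of_iso e 0
      exact t.isLE_of_le X 0 1
    · have : t.IsLE (t.heart.ι.obj Y) 0 := heart_isLE Y
      have : t.IsLE (X⟦(1 : ℤ)⟧) 0 := t.isLE_of_iso e 0
      exact t.isLE_of_shift X 1 1 0
  | of_iso X Y e _ _ => exact t.isLE_of_iso e 1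
  | ext X Y Z f g h hT _ _ hX hZ => exact t.isLE₂ _ hT 1 hX hZ

/-- There are no nonzero morphisms from torsion objects to the tilted heart. -/
lemma hom_tilt_eq_zero {X : D} (hX : τ.tilt X) {Z : t.heart.FullSubcategory} (hZ : τ.T Z)
    (f : Z.obj ⟶ X) : f = 0 := by
  have := heart_isLE Z
  induction hX with
  | of X hX =>
    obtain ⟨Y, hY, ⟨e⟩⟩ | ⟨Y, hY, ⟨e⟩⟩ := hX
    · rw [← cancel_mono e.inv, zero_comp]
      exact τ.hom_obj_eq_zero _ hZ hY
    · have : t.IsGE (t.heart.ι.obj Y) 0 := heart_isGE Y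
      have : t.IsGE (X⟦(1 : ℤ)⟧) 0 := t.isGE_of_iso e 0
      have := t.isGE_of_shift X 1 1 0
      exact t.zero f 0 1
  | of_iso X Y e _ ih => rw [← cancel_mono e.inv, zero_comp, ih (f ≫ e.inv)]
  | ext X Y W a b c hT _ _ hX hW =>
    obtain ⟨φ, rfl⟩ := Triangle.coyoneda_exact₂ _ hT f (hW _)
    exact (congrArg (· ≫ a) (hX φ)).trans zero_comp

/-- There are no nonzero morphisms from the tilted heart to objects of `F[-1]`. -/
lemma tilt_hom_eq_zero {X : D} (hX : τ.tilt X) {Y : t.heart.FullSubcategory} (hY : τ.F Y)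
    {W : D} (e : W⟦(1 : ℤ)⟧ ≅ Y.obj) (f : X ⟶ W) : f = 0 := by
  have := heart_isGE Y
  have : t.IsGE (W⟦(1 : ℤ)⟧) 0 := t.isGE_of_iso e.symm 0
  have := t.isGE_of_shift W 1 1 0
  induction hX with
  | of X hX =>
    obtain ⟨Z, hZ, ⟨e'⟩⟩ | ⟨Z, hZ, ⟨e'⟩⟩ := hX
    · have : t.IsLE (t.heart.ι.obj Z) 0 := heart_isLE Z
      have : t.IsLE X 0 := t.isLE_of_iso e' 0
      exact t.zero f 0 1
    · apply (shiftFunctor D (1 : ℤ)).map_injective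
      rw [Functor.map_zero, ← cancel_mono e.hom, ← cancel_epi e'.hom, zero_comp, comp_zero]
      exact τ.hom_obj_eq_zero _ hZ hY
  | of_iso X Y e _ ih => rw [← cancel_epi e.hom, comp_zero, ih (e.hom ≫ f)]
  | ext X Y Z a b c hT _ _ hX hZ =>
    obtain ⟨φ, rfl⟩ := Triangle.yoneda_exact₂ _ hT f (hX _)
    exact (congrArg (b ≫ ·) (hZ φ)).trans comp_zero

/-- Every object of the tilted heart is an extension of an object of `T[-1]` by an object
of `F`. -/
lemma exists_triangle_of_tilt {X : D} (hX : τ.tilt X) :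
    ∃ (Y Z : t.heart.FullSubcategory) (f : Y.obj ⟶ X) (g : X ⟶ Z.obj⟦(-1 : ℤ)⟧)
      (h : Z.obj⟦(-1 : ℤ)⟧ ⟶ Y.obj⟦(1 : ℤ)⟧),
      τ.F Y ∧ τ.T Z ∧ Triangle.mk f g h ∈ distTriang D := by
  have := τ.tilt_isGE hX
  have := τ.tilt_isLE hX
  let L := (t.truncLE 0).obj X
  let G := (t.truncGE 1).obj X
  have hL : t.IsLE L 0 := inferInstance
  have hL' : t.IsGE L 0 := inferInstance
  have hG : t.IsLE G 1 := inferInstance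
  have hG' : t.IsGE G 1 := inferInstance
  have hT := t.triangleLEGE_distinguished 0 1 (by simp) X
  let Y : t.heart.FullSubcategory := ⟨L, hL.le, hL'.ge⟩
  let Z : t.heart.FullSubcategory :=
    ⟨G⟦(1 : ℤ)⟧, (t.isLE_shift G 1 1 0).le, (t.isGE_shift G 1 1 0).ge⟩
  let e : Z.obj⟦(-1 : ℤ)⟧ ≅ G := (shiftFunctorCompIsoId D 1 (-1) (by simp)).app G
  refine ⟨Y, Z, (t.truncLEι 0).app X, (t.truncGEπ 1).app X ≫ e.inv,
    e.hom ≫ (t.truncGEδLE 0 1 (by simp)).app X, ?_, ?_, ?_⟩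
  -- A map from `T` to the truncation is determined by its composite into `X`, which is zero.
  · refine τ.F_of_hom_eq_zero fun W f hW ↦ ?_
    have := heart_isLE W
    ext
    exact t.to_truncLE_obj_ext
      ((τ.hom_tilt_eq_zero hX hW _).trans zero_comp.symm)
  -- Dually, desuspend `f` to a map `G ⟶ W[-1]`, determined by its restriction to `X`.
  · refine τ.T_of_hom_eq_zero fun W f hW ↦ ?_
    have := heart_isGE W
    let e' : (W.obj⟦(-1 : ℤ)⟧)⟦(1 : ℤ)⟧ ≅ W.obj :=
      (shiftFunctorCompIsoId D (-1) 1 (by simp)).app W.obj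
    have : t.IsGE (W.obj⟦(-1 : ℤ)⟧) 1 := t.isGE_shift W.obj 0 (-1) 1
    obtain ⟨φ, hφ⟩ : ∃ φ : G ⟶ W.obj⟦(-1 : ℤ)⟧, φ⟦(1 : ℤ)⟧' = f.hom ≫ e'.inv :=
      (shiftFunctor D (1 : ℤ)).map_surjective _
    have hφ' : φ = 0 := t.from_truncGE_obj_ext
      ((τ.tilt_hom_eq_zero hX hW e' _).trans comp_zero.symm)
    ext
    change f.hom = 0
    rw [← cancel_mono e'.inv, ← hφ, hφ', Functor.map_zero, zero_comp]
  · exact isomorphic_distinguished _ hT _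
      (Triangle.isoMk _ _ (Iso.refl _) (Iso.refl _) e
        ((Category.comp_id _).trans (Category.id_comp _).symm)
        (show ((t.truncGEπ 1).app X ≫ e.inv) ≫ e.hom = 𝟙 _ ≫ (t.truncGEπ 1).app X by simp)
        (show (e.hom ≫ (t.truncGEδLE 0 1 (by simp)).app X) ≫ (𝟙 _)⟦(1 : ℤ)⟧' =
          e.hom ≫ (t.truncGEδLE 0 1 (by simp)).app X by simp))

/-- Every object of the shifted tilted heart is an extension of an object of `T` by an object
of `F[1]`. -/
lemma exists_triangle_of_tiltShift {X : D} (hX : τ.tiltShift X) :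
    ∃ (Y Z : t.heart.FullSubcategory) (f : Y.obj⟦(1 : ℤ)⟧ ⟶ X) (g : X ⟶ Z.obj)
      (h : Z.obj ⟶ (Y.obj⟦(1 : ℤ)⟧)⟦(1 : ℤ)⟧),
      τ.F Y ∧ τ.T Z ∧ Triangle.mk f g h ∈ distTriang D := by
  obtain ⟨Y, Z, f, g, h, hY, hZ, hT⟩ := τ.exists_triangle_of_tilt hX
  -- Shifting introduces signs; they stay inside the morphisms of `S`.
  let S := (Triangle.shiftFunctor D 1).obj (Triangle.mk f g h)
  have hS : S ∈ distTriang D := Triangle.shift_distinguished _ hT 1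
  let e₂ : S.obj₂ ≅ X := (shiftFunctorCompIsoId D (-1) 1 (by simp)).app X
  let e₃ : S.obj₃ ≅ Z.obj := (shiftFunctorCompIsoId D (-1) 1 (by simp)).app Z.obj
  refine ⟨Y, Z, S.mor₁ ≫ e₂.hom, e₂.inv ≫ S.mor₂ ≫ e₃.hom, e₃.inv ≫ S.mor₃, hY, hZ,
    isomorphic_distinguished _ hS _
      (Triangle.isoMk _ _ (Iso.refl _) e₂.symm e₃.symm ?_ ?_ ?_)⟩
  · change (S.mor₁ ≫ e₂.hom) ≫ e₂.inv = 𝟙 _ ≫ S.mor₁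
    simp
  · change (e₂.inv ≫ S.mor₂ ≫ e₃.hom) ≫ e₃.inv = e₂.inv ≫ S.mor₂
    simp
  · change (e₃.inv ≫ S.mor₃) ≫ (𝟙 _)⟦(1 : ℤ)⟧' = e₃.inv ≫ S.mor₃
    simp

/-- Makes `Z[-1]` an admissible test object when cancelling an epimorphism of `A^#`. -/
lemma tilt_shift_of_T {Z : t.heart.FullSubcategory} (hZ : τ.T Z) :
    τ.tilt (Z.obj⟦(-1 : ℤ)⟧) :=
  τ.tiltShift_of_T hZ

lemma tiltShift_shift_of_F {Y : t.heart.FullSubcategory} (hY : τ.F Y) :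
    τ.tiltShift (Y.obj⟦(1 : ℤ)⟧) :=
  .of_iso _ _ ((shiftFunctorCompIsoId D (1 : ℤ) (-1) (by simp)).app Y.obj).symm
    (τ.tilt_of_F hY)

/-! ### The two characterizations -/

/-- Epimorphisms in the tilted heart whose source is a torsion-free object of the heart. -/
theorem epi_tilt_iff (E₀ : t.heart.FullSubcategory) (hE₀ : τ.F E₀) (E : τ.tilt.FullSubcategory)
    (α : (⟨E₀.obj, τ.tilt_of_F hE₀⟩ : τ.tilt.FullSubcategory) ⟶ E) :
    Epi α ↔ ∃ hE : t.heart E.obj, τ.F ⟨E.obj, hE⟩ ∧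
      τ.T (cokernel (ObjectProperty.homMk α.hom : E₀ ⟶ ⟨E.obj, hE⟩)) := by
  have hLE₀ := heart_isLE E₀
  constructor
  · intro hα
    obtain ⟨Y, Z, f, g, h, hY, hZ, hT⟩ := τ.exists_triangle_of_tilt E.property
    have hYLE := heart_isLE Y
    have hZGE := heart_isGE Z
    have : t.IsGE (Z.obj⟦(-1 : ℤ)⟧) 1 := t.isGE_shift Z.obj 0 (-1) 1
    have : t.IsLE (Y.obj⟦(1 : ℤ)⟧) (-1) := t.isLE_shift Y.obj 0 1 (-1)
    have hg : g = 0 := by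
      let γ : E ⟶ (⟨_, τ.tilt_shift_of_T hZ⟩ : τ.tilt.FullSubcategory) :=
        ObjectProperty.homMk g
      have : γ = 0 := by
        rw [← cancel_epi α, comp_zero]
        ext
        exact t.zero (α.hom ≫ g) 0 1
      exact congrArg (fun φ ↦ φ.hom) this
    -- As `g = 0`, the identity of `Z[-1]` factors through `Y[1]`, but there are no maps from
    -- degrees `≤ -1` to degrees `≥ 1`.
    have hZ0 : IsZero (Z.obj⟦(-1 : ℤ)⟧) := by
      obtain ⟨r, hr⟩ : ∃ r : Y.obj⟦(1 : ℤ)⟧ ⟶ Z.obj⟦(-1 : ℤ)⟧, 𝟙 _ = h ≫ r :=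
        Triangle.yoneda_exact₃ _ hT (𝟙 (Z.obj⟦(-1 : ℤ)⟧)) ((Category.comp_id g).trans hg)
      rw [IsZero.iff_id_eq_zero, hr, t.zero r (-1) 1, comp_zero]
    have : IsIso f := (Triangle.isZero₃_iff_isIso₁ _ hT).1 hZ0
    have hE : t.heart E.obj := t.heart.prop_of_iso (asIso f) Y.property
    have hFE : τ.F ⟨E.obj, hE⟩ := by
      have := τ.closed_F
      exact τ.F.prop_of_iso (t.heart.isoMk (asIso f)) hY
    refine ⟨hE, hFE, τ.T_of_hom_eq_zero fun W φ hW ↦ ?_⟩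
    let a : E₀ ⟶ ⟨E.obj, hE⟩ := ObjectProperty.homMk α.hom
    let γ : E ⟶ (⟨W.obj, τ.tilt_of_F hW⟩ : τ.tilt.FullSubcategory) :=
      ObjectProperty.homMk (cokernel.π a ≫ φ).hom
    have hγ : γ = 0 := by
      rw [← cancel_epi α, comp_zero]
      ext
      exact congrArg (fun ψ : E₀ ⟶ W ↦ ψ.hom)
        (show a ≫ cokernel.π a ≫ φ = 0 by rw [cokernel.condition_assoc, zero_comp])
    rw [← cancel_epi (cokernel.π a), comp_zero]
    ext
    exact congrArg (fun ψ ↦ ψ.hom) hγ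
  · rintro ⟨hE, hFE, hQ⟩
    refine Preadditive.epi_of_cancel_zero _ fun {G} γ hγ ↦ ?_
    obtain ⟨Y, Z, f, g, h, hY, hZ, hT⟩ := τ.exists_triangle_of_tilt G.property
    have hZGE := heart_isGE Z
    have hELE : t.IsLE E.obj 0 := ⟨hE.1⟩
    have : t.IsGE (Z.obj⟦(-1 : ℤ)⟧) 1 := t.isGE_shift Z.obj 0 (-1) 1
    -- `Z[-2]` precedes `Y` in the rotated triangle: a map `E₀ ⟶ Y` killed by `f` factors through
    -- it, hence vanishes.
    have : t.IsGE ((Z.obj⟦(-1 : ℤ)⟧)⟦(-1 : ℤ)⟧) 2 := t.isGE_shift _ 1 (-1) 2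
    obtain ⟨φ, hφ⟩ : ∃ φ : E.obj ⟶ Y.obj, γ.hom = φ ≫ f :=
      Triangle.coyoneda_exact₂ _ hT γ.hom (t.zero (γ.hom ≫ g) 0 1)
    let a : E₀ ⟶ ⟨E.obj, hE⟩ := ObjectProperty.homMk α.hom
    let b : (⟨E.obj, hE⟩ : t.heart.FullSubcategory) ⟶ Y := ObjectProperty.homMk φ
    have hab : a ≫ b = 0 := by
      ext
      change α.hom ≫ φ = 0
      have hαφ : (α.hom ≫ φ) ≫ f = 0 := by
        rw [Category.assoc, ← hφ]
        exact congrArg (fun ψ ↦ ψ.hom) hγ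
      obtain ⟨ψ, hψ⟩ : ∃ ψ : E₀.obj ⟶ (Z.obj⟦(-1 : ℤ)⟧)⟦(-1 : ℤ)⟧,
          α.hom ≫ φ = ψ ≫ (Triangle.mk f g h).invRotate.mor₁ :=
        Triangle.coyoneda_exact₂ _ (inv_rot_of_distTriang _ hT) (α.hom ≫ φ) hαφ
      rw [hψ, t.zero ψ 0 2]
      exact zero_comp
    have hb : b = 0 := by
      rw [← cokernel.π_desc a b hab, τ.hom_eq_zero (cokernel.desc a b hab) hQ hY, comp_zero]
    ext
    rw [hφ]
    exact (congrArg (fun ψ ↦ ψ.hom ≫ f) hb).trans zero_comp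

/-- Monomorphisms in the shifted tilted heart whose target is a torsion object of the heart. -/
theorem mono_tiltShift_iff (E₀ : t.heart.FullSubcategory) (hE₀ : τ.T E₀)
    (E : τ.tiltShift.FullSubcategory)
    (β : E ⟶ (⟨E₀.obj, τ.tiltShift_of_T hE₀⟩ : τ.tiltShift.FullSubcategory)) :
    Mono β ↔ ∃ hE : t.heart E.obj, τ.T ⟨E.obj, hE⟩ ∧
      τ.F (kernel
        (ObjectProperty.homMk β.hom : (⟨E.obj, hE⟩ : t.heart.FullSubcategory) ⟶ E₀)) := by
  have hGE₀ := heart_isGE E₀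
  constructor
  · intro hβ
    obtain ⟨Y, Z, f, g, h, hY, hZ, hT⟩ := τ.exists_triangle_of_tiltShift E.property
    have hYLE := heart_isLE Y
    have hZGE := heart_isGE Z
    have : t.IsLE (Y.obj⟦(1 : ℤ)⟧) (-1) := t.isLE_shift Y.obj 0 1 (-1)
    have : t.IsLE ((Y.obj⟦(1 : ℤ)⟧)⟦(1 : ℤ)⟧) (-2) := t.isLE_shift _ (-1) 1 (-2)
    have hf : f = 0 := by
      let γ : (⟨_, τ.tiltShift_shift_of_F hY⟩ : τ.tiltShift.FullSubcategory) ⟶ E :=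
        ObjectProperty.homMk f
      have : γ = 0 := by
        rw [← cancel_mono β, zero_comp]
        ext
        exact t.zero (f ≫ β.hom) (-1) 0
      exact congrArg (fun φ ↦ φ.hom) this
    have hY0 : IsZero (Y.obj⟦(1 : ℤ)⟧) := by
      refine (Triangle.isZero₁_iff _ hT).2 ⟨hf, ?_⟩
      change h = 0
      -- As `f = 0`, the identity of `Y[2]` factors through `Z`, and maps from degrees `≤ -2` to
      -- degrees `≥ 0` vanish.
      obtain ⟨s, hs⟩ : ∃ s : (Y.obj⟦(1 : ℤ)⟧)⟦(1 : ℤ)⟧ ⟶ Z.obj, 𝟙 _ = s ≫ h :=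
        Triangle.coyoneda_exact₁ _ hT (𝟙 ((Y.obj⟦(1 : ℤ)⟧)⟦(1 : ℤ)⟧)) (by
          change 𝟙 _ ≫ f⟦(1 : ℤ)⟧' = 0
          rw [hf, Functor.map_zero, comp_zero])
      rw [← Category.comp_id h, hs, t.zero s (-2) 0, zero_comp, comp_zero]
    have : IsIso g := (Triangle.isZero₁_iff_isIso₂ _ hT).1 hY0
    have hE : t.heart E.obj := t.heart.prop_of_iso (asIso g).symm Z.property
    have hTE : τ.T ⟨E.obj, hE⟩ := by
      have := τ.closed_T
      exact τ.T.prop_of_iso (t.heart.isoMk (asIso g).symm) hZ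
    refine ⟨hE, hTE, τ.F_of_hom_eq_zero fun W φ hW ↦ ?_⟩
    let b : (⟨E.obj, hE⟩ : t.heart.FullSubcategory) ⟶ E₀ := ObjectProperty.homMk β.hom
    let γ : (⟨W.obj, τ.tiltShift_of_T hW⟩ : τ.tiltShift.FullSubcategory) ⟶ E :=
      ObjectProperty.homMk (φ ≫ kernel.ι b).hom
    have hγ : γ = 0 := by
      rw [← cancel_mono β, zero_comp]
      ext
      exact congrArg (fun ψ : W ⟶ E₀ ↦ ψ.hom)
        (show (φ ≫ kernel.ι b) ≫ b = 0 by rw [Category.assoc, kernel.condition, comp_zero])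
    rw [← cancel_mono (kernel.ι b), zero_comp]
    ext
    exact congrArg (fun ψ ↦ ψ.hom) hγ
  · rintro ⟨hE, hTE, hK⟩
    refine Preadditive.mono_of_cancel_zero _ fun {G} γ hγ ↦ ?_
    obtain ⟨Y, Z, f, g, h, hY, hZ, hT⟩ := τ.exists_triangle_of_tiltShift G.property
    have hYLE := heart_isLE Y
    have hEGE : t.IsGE E.obj 0 := ⟨hE.2⟩
    have : t.IsLE (Y.obj⟦(1 : ℤ)⟧) (-1) := t.isLE_shift Y.obj 0 1 (-1)
    -- `Y[2]` follows `Z` in the triangle: a map `Z ⟶ E₀` killed by `g` factors through it, hence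
    -- vanishes.
    have : t.IsLE ((Y.obj⟦(1 : ℤ)⟧)⟦(1 : ℤ)⟧) (-2) := t.isLE_shift _ (-1) 1 (-2)
    obtain ⟨φ, hφ⟩ : ∃ φ : Z.obj ⟶ E.obj, γ.hom = g ≫ φ :=
      Triangle.yoneda_exact₂ _ hT γ.hom (t.zero (f ≫ γ.hom) (-1) 0)
    let b : (⟨E.obj, hE⟩ : t.heart.FullSubcategory) ⟶ E₀ := ObjectProperty.homMk β.hom
    let a : Z ⟶ (⟨E.obj, hE⟩ : t.heart.FullSubcategory) := ObjectProperty.homMk φ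
    have hab : a ≫ b = 0 := by
      ext
      change φ ≫ β.hom = 0
      have hφβ : g ≫ φ ≫ β.hom = 0 := by
        rw [← Category.assoc, ← hφ]
        exact congrArg (fun ψ ↦ ψ.hom) hγ
      obtain ⟨ψ, hψ⟩ : ∃ ψ : (Y.obj⟦(1 : ℤ)⟧)⟦(1 : ℤ)⟧ ⟶ E₀.obj, φ ≫ β.hom = h ≫ ψ :=
        Triangle.yoneda_exact₃ _ hT (φ ≫ β.hom) hφβ
      rw [hψ, t.zero ψ (-2) 0, comp_zero]
    have ha : a = 0 := by
      rw [← kernel.lift_ι b a hab, τ.hom_eq_zero (kernel.lift b a hab) hZ hK, zero_comp]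
    ext
    rw [hφ]
    exact (congrArg (fun ψ ↦ g ≫ ψ.hom) ha).trans comp_zero

end TorsionPair

end Tilting

theorem mainTheorem1 {D : Type*} [Category* D] [Preadditive D] [HasZeroObject D] [HasShift D ℤ]
    [∀ n : ℤ, (shiftFunctor D n).Additive] [Pretriangulated D] [IsTriangulated D]
    (t : TStructure D) (ht : ∀ X : D, t.bounded X)
    (τ : Tilting.TorsionPair t.heart.FullSubcategory) :
    (∀ (E₀ : t.heart.FullSubcategory) (hE₀ : τ.F E₀) (E : τ.tilt.FullSubcategory)
      (α : (⟨E₀.obj, τ.tilt_of_F hE₀⟩ : τ.tilt.FullSubcategory) ⟶ E),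
      Epi α ↔ ∃ hE : t.heart E.obj, τ.F ⟨E.obj, hE⟩ ∧
        τ.T (cokernel (ObjectProperty.homMk α.hom : E₀ ⟶ ⟨E.obj, hE⟩))) ∧
    (∀ (E₀ : t.heart.FullSubcategory) (hE₀ : τ.T E₀) (E : τ.tiltShift.FullSubcategory)
      (β : E ⟶ (⟨E₀.obj, τ.tiltShift_of_T hE₀⟩ : τ.tiltShift.FullSubcategory)),
      Mono β ↔ ∃ hE : t.heart E.obj, τ.T ⟨E.obj, hE⟩ ∧
        τ.F (kernel
          (ObjectProperty.homMk β.hom : (⟨E.obj, hE⟩ : t.heart.FullSubcategory) ⟶ E₀))) :=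
  ⟨τ.epi_tilt_iff, τ.mono_tiltShift_iff⟩
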